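/- Let $(E,e,T)$ be a conditional Riesz triple: $E$ is a Dedekind complete Riesz space, $e$ a weak order unit of $E$, and $T$ a strictly positive conditional expectation operator on $E$, i.e. an order continuous linear projection with $Te=e$, with $Tf>0$ whenever $f>0$, and whose range $R(T)$ is a Dedekind complete Riesz subspace. Let $E^s$ be the sup-completion of $E$; sums of positive elements are taken in $E^s$ (suprema of finite partial sums), and $T$ and band projections are extended to $E^s$ by preserving suprema. Let $P_u$ denote the band projection onto the band generated by $u$, and put $P_{x>y}=P_{(x-y)^+}$, $P_{x\le y}=I-P_{(x-y)^+}$, $P_{x=y}=I-P_{|x-y|}$. An element $x$ is *natural* if $\sum_{n\ge 0}TP_{x=ne}e=e$, and its generating function is $$g_x(s)=\sum_{n\ge 0}s^n\,TP_{x=ne}e\in E^s\qquad(s\ge 0).$$ Elements are *$T$-equidistributed* if they have the same distribution function $t\mapsto TP_{x\le te}e$, $t\in\mathbb R$. Elements $x,y$ are *$T$-independent* if $TPQe=TPTQe$ and $TQPe=TQTPe$ for all band projections $P,Q$ such that $Pe$ and $Qe$ lie in the order closed Riesz subspaces generated by $\{x\}\cup R(T)$ and $\{y\}\cup R(T)$,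 respectively. **Theorem (generating function of $x_N$).** Let $N,x_1,x_2,\dots$ be natural elements of $E$ such that $x_1,x_2,\dots$ are $T$-equidistributed and each $x_n$ is $T$-independent of $N$. Write $x=x_1$ and $x_N=\sum_{n\ge 1}P_{N=ne}x_n$ (an element of $E^s$, and of $E$ if the series is order convergent there; the mass function, naturality and the generating function of $x_N$ are understood in $E^s$, with $P_{x_N=ne}:=P_{x_N\wedge(n+1)e=ne}$, which agrees with the definition above if $x_N\in E$). Then $x_N$ is natural and, for every $s\ge 0$, $$g_{x_N}(s)=T(I-P_{N=0})\,g_x(s)+TP_{N=0}e\quad\text{in }E^s .$$ Moreover, if $TP_{N>0}e=e$, then $g_{x_N}(s)=g_x(s)$ for every $s\ge 0$. -/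

import Mathlib

namespace RieszProb

section Sup

variable {E : Type*} [ConditionallyCompleteLattice E]

/-- The sup-completion `Eˢ` of a Dedekind complete Riesz space `E`, realised concretely: an element
`z` of `Eˢ` is determined by the set `{u ∈ E | u ≤ z}`, and the sets that occur are exactly the
nonempty lower subsets of `E` that are closed under all suprema existing in `E`.
For `E = ℝ` this is `(-∞, ∞]`. -/
@[ext]
structure SupCompletion (E : Type*) [ConditionallyCompleteLattice E] where
  carrier : Set E
  nonempty' : carrier.Nonempty
  lower' : ∀ u v : E, u ≤ v → v ∈ carrier → u ∈ carrier
  sup_closed' : ∀ S : Set E, S ⊆ carrier → S.Nonempty → ∀ a : E, IsLUB S a → a ∈ carrier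

namespace SupCompletion

instance : PartialOrder (SupCompletion E) where
  le z w := z.carrier ⊆ w.carrier
  le_refl _ := subset_rfl
  le_trans _ _ _ h₁ h₂ := h₁.trans h₂
  le_antisymm _ _ h₁ h₂ := SupCompletion.ext (h₁.antisymm h₂)

/-- The embedding of `E` into its sup-completion. -/
def of (x : E) : SupCompletion E where
  carrier := Set.Iic x
  nonempty' := ⟨x, le_refl x⟩
  lower' _ _ h hv := le_trans h hv
  sup_closed' _ hS _ _ ha := ha.2 hS

/-- The supremum in `Eˢ` of a nonempty subset `A` of `E`: the least element of `Eˢ` above `A`. -/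
def sup (A : Set E) (hA : A.Nonempty) : SupCompletion E where
  carrier := {y | ∀ D : SupCompletion E, A ⊆ D.carrier → y ∈ D.carrier}
  nonempty' := hA.imp fun _ ha _ hD => hD ha
  lower' u v h hv D hD := D.lower' u v h (hv D hD)
  sup_closed' S hS hne a ha D hD := D.sup_closed' S (fun _ hu => hS hu D hD) hne a ha

theorem of_le_iff (x : E) (z : SupCompletion E) : of x ≤ z ↔ x ∈ z.carrier :=
  ⟨fun h => h (le_refl x), fun h _ hu => z.lower' _ _ hu h⟩

/-- `sup A` is the supremum in `Eˢ` of the image of `A`. -/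
theorem isLUB_sup (A : Set E) (hA : A.Nonempty) : IsLUB (of '' A) (sup A hA) := by
  constructor
  · rintro _ ⟨a, ha, rfl⟩
    exact (of_le_iff _ _).2 fun D hD => hD ha
  · intro z hz y hy
    exact hy z fun a ha => (of_le_iff a z).1 (hz ⟨a, ha, rfl⟩)

/-- The supremum in `Eˢ` is an element of `E` exactly if it is the supremum in `E`. -/
theorem sup_eq_of_iff (A : Set E) (hA : A.Nonempty) (a : E) : sup A hA = of a ↔ IsLUB A a := by
  constructor
  · intro h
    have hl := isLUB_sup A hA
    rw [h] at hl
    refine ⟨fun u hu => (of_le_iff u _).1 (hl.1 ⟨u, hu, rfl⟩), fun b hb => ?_⟩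
    refine (of_le_iff a _).1 (hl.2 ?_ : of a ≤ of b)
    rintro _ ⟨u, hu, rfl⟩
    exact (of_le_iff u _).2 (hb hu)
  · intro h
    refine le_antisymm (fun y hy => hy (of a) h.1) ?_
    exact (of_le_iff a _).2 fun D hD => D.sup_closed' A hD hA a h

/-- The extension to `Eˢ` of an increasing order continuous map of `E` (such as a conditional
expectation operator or a band projection): `f (sup A) = sup f(A)`. -/
def map (f : E → E) (z : SupCompletion E) : SupCompletion E :=
  sup (f '' z.carrier) (z.nonempty'.image f)

/-- Truncation: the infimum `z ∧ w` of `z ∈ Eˢ` and `w ∈ E`, which is an element of `E`. -/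
noncomputable def trunc (z : SupCompletion E) (w : E) : E :=
  sSup {u | u ∈ z.carrier ∧ u ≤ w}

theorem trunc_of (x w : E) : (of x).trunc w = x ⊓ w := by
  apply IsLUB.csSup_eq
  · exact ⟨fun u hu => le_inf hu.1 hu.2, fun b hb => hb ⟨inf_le_left, inf_le_right⟩⟩
  · exact ⟨x ⊓ w, inf_le_left, inf_le_right⟩

/-- Addition in `Eˢ`. -/
instance [Add E] : Add (SupCompletion E) where
  add z w := sup (Set.image2 (· + ·) z.carrier w.carrier) (z.nonempty'.image2 w.nonempty')

/-- The sum in `Eˢ` of a sequence of positive elements of `E`: the supremum of all finite partial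
sums. It is an element of `E` exactly if the series converges in order in `E`. -/
def tsum [AddCommMonoid E] (f : ℕ → E) : SupCompletion E :=
  sup (Set.range fun F : Finset ℕ => ∑ i ∈ F, f i) (Set.range_nonempty _)

end SupCompletion

end Sup

variable {E : Type*} [ConditionallyCompleteLattice E] [AddCommGroup E] [IsOrderedAddMonoid E]

/-- `e` is a weak order unit. -/
def IsWeakOrderUnit (e : E) : Prop :=
  0 ≤ e ∧ ∀ x : E, |x| ⊓ e = 0 → x = 0

theorem iSup_inf_nsmul_eq {e : E} (he : IsWeakOrderUnit e) (a y : E) (hy : 0 ≤ y) :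
    ⨆ n : ℕ, y ⊓ n • |a ⊓ e| = ⨆ n : ℕ, y ⊓ n • |a| := by
  have hcb : |a ⊓ e| ≤ |a| := by
    apply abs_le'.2
    refine ⟨inf_le_left.trans (le_abs_self a), ?_⟩
    rw [neg_inf]
    exact sup_le (neg_le_abs a) ((neg_nonpos.2 he.1).trans (abs_nonneg a))
  have hbe : |a| ⊓ e ≤ |a ⊓ e| := by
    let _ : DistribLattice E := AddCommGroup.toDistribLattice E
    have h : |a| ⊓ e = (a ⊓ e) ⊔ (-a ⊓ e) := by
      change (a ⊔ -a) ⊓ e = _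
      exact inf_sup_right a (-a) e
    rw [h]
    refine sup_le (le_abs_self _) (inf_le_left.trans ?_)
    exact (neg_le_neg inf_le_left).trans (neg_le_abs _)
  have bdd : ∀ w : E, BddAbove (Set.range fun n : ℕ => y ⊓ n • w) := fun w =>
    ⟨y, by rintro _ ⟨n, rfl⟩; exact inf_le_left⟩
  apply le_antisymm
  · exact ciSup_mono (bdd _) fun n => inf_le_inf_left _ (nsmul_le_nsmul_right hcb n)
  · apply ciSup_le
    intro m
    set c := |a ⊓ e| with hc
    set b := |a| with hb
    set S := ⨆ n : ℕ, y ⊓ n • c with hS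
    have hSy : S ≤ y := ciSup_le fun n => inf_le_left
    have hS0 : 0 ≤ S := by
      have := le_ciSup (bdd c) 0
      simpa [hy] using this
    set r := (y ⊓ m • b - S) ⊔ 0 with hr
    have hr0 : 0 ≤ r := le_sup_right
    have hrS : r + S ≤ y := by
      have : r ≤ y - S := sup_le (sub_le_sub_right inf_le_left S) (sub_nonneg.2 hSy)
      exact le_sub_iff_add_le.1 this
    have hmb : 0 ≤ m • b := nsmul_nonneg (abs_nonneg a) m
    have hrb : r ≤ m • b :=
      sup_le ((sub_le_self _ hS0).trans inf_le_right) hmb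
    have hrc : r ⊓ c ≤ 0 := by
      have h1 : S ≤ S - r ⊓ c := by
        apply ciSup_le
        intro n
        rw [le_sub_iff_add_le]
        refine le_trans ?_ (le_ciSup (bdd c) (n + 1))
        refine le_inf ?_ ?_
        · calc y ⊓ n • c + r ⊓ c ≤ S + r := add_le_add (le_ciSup (bdd c) n) inf_le_left
            _ ≤ y := by rw [add_comm]; exact hrS
        · rw [succ_nsmul]
          exact add_le_add inf_le_right inf_le_right
      simpa using h1
    have hrb0 : r ⊓ b = 0 := by
      have h0 : 0 ≤ r ⊓ b := le_inf hr0 (abs_nonneg a)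
      apply he.2
      rw [abs_of_nonneg h0]
      refine le_antisymm ?_ (le_inf h0 he.1)
      refine le_trans ?_ hrc
      rw [inf_assoc]
      exact inf_le_inf_left _ hbe
    have key : ∀ k : ℕ, r ≤ k • b → r ≤ 0 := by
      intro k
      induction k with
      | zero => intro h; simpa using h
      | succ k ih =>
        intro h
        apply ih
        have h1 : r - k • b ≤ r ⊓ b := by
          refine le_inf (sub_le_self _ (nsmul_nonneg (abs_nonneg a) k)) ?_
          rw [sub_le_iff_le_add, ← succ_nsmul']
          exact h
        rw [hrb0] at h1
        exact sub_nonpos.1 h1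
    exact sub_nonpos.1 (le_sup_left.trans (key m hrb))

variable [Module ℝ E]

/-- `(E, e, T)` is a conditional Riesz triple, with `T` strictly positive. -/
structure IsConditionalRieszTriple (e : E) (T : E →ₗ[ℝ] E) : Prop where
  weak_unit : IsWeakOrderUnit e
  positive : ∀ x : E, 0 ≤ x → 0 ≤ T x
  order_continuous : ∀ S : Set E, S.Nonempty → DirectedOn (· ≥ ·) S → IsGLB S 0 →
    IsGLB (T '' S) 0
  projection : ∀ x : E, T (T x) = T x
  map_unit : T e = e
  range_riesz : ∀ x ∈ LinearMap.range T, ∀ y ∈ LinearMap.range T, x ⊔ y ∈ LinearMap.range T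
  range_complete : ∀ S : Set (LinearMap.range T), S.Nonempty → BddAbove S → ∃ a, IsLUB S a
  strictly_positive : ∀ x : E, 0 < x → 0 < T x

/-- The band projection `P_u` onto the principal band generated by `u`:
`P_u v = sup_n (v ∧ n|u|)` for `v ≥ 0`, and `P_u v = P_u v⁺ - P_u v⁻` in general. -/
noncomputable def bandProj (u v : E) : E :=
  (⨆ n : ℕ, v⁺ ⊓ n • |u|) - ⨆ n : ℕ, v⁻ ⊓ n • |u|

/-- The band projection `P_{x = y} = I - P_{|x - y|}`. -/
noncomputable def bandEq (x y v : E) : E := v - bandProj |x - y| v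

/-- The band projection `P_{x > y} = P_{(x - y)⁺}`. -/
noncomputable def bandGt (x y v : E) : E := bandProj (x - y)⁺ v

/-- The band projection `P_{x ≤ y} = I - P_{(x - y)⁺}`. -/
noncomputable def bandLe (x y v : E) : E := v - bandProj (x - y)⁺ v

/-- The `T`-distribution function `F_x(t) = T P_{x ≤ te} e`. -/
noncomputable def distFun (e : E) (T : E →ₗ[ℝ] E) (x : E) (t : ℝ) : E := T (bandLe x (t • e) e)

/-- The mass function `π_x(t) = T P_{x = te} e`. -/
noncomputable def mass (e : E) (T : E →ₗ[ℝ] E) (x : E) (t : ℝ) : E := T (bandEq x (t • e) e)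

/-- `x` is natural: `∑_{n ≥ 0} π_x(n) = e` in order. -/
def IsNatural (e : E) (T : E →ₗ[ℝ] E) (x : E) : Prop :=
  SupCompletion.tsum (fun n : ℕ => mass e T x n) = SupCompletion.of e

/-- The `T`-generating function `g_x(s) = ∑_{n ≥ 0} sⁿ π_x(n)`, with values in `Eˢ`. -/
noncomputable def genFun (e : E) (T : E →ₗ[ℝ] E) (x : E) (s : ℝ) : SupCompletion E :=
  SupCompletion.tsum fun n : ℕ => s ^ n • mass e T x n

section Extended

/-- The mass function `T P_{z = te} e` of an element `z` of `Eˢ`. Here `P_{z = te}` is computed on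
the truncation `z ∧ (t+1)e`, an element of `E`, since `z` equals `te` where that truncation does
(`P_{x = te} = P_{x ∧ (t+1)e = te}` for `x ∈ E`, see `massExt_of`). -/
noncomputable def massExt (e : E) (T : E →ₗ[ℝ] E) (z : SupCompletion E) (t : ℝ) : E :=
  mass e T (z.trunc ((t + 1) • e)) t

/-- `z ∈ Eˢ` is natural. -/
def IsNaturalExt (e : E) (T : E →ₗ[ℝ] E) (z : SupCompletion E) : Prop :=
  SupCompletion.tsum (fun n : ℕ => massExt e T z n) = SupCompletion.of e

/-- The `T`-generating function of an element of `Eˢ`. -/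
noncomputable def genFunExt (e : E) (T : E →ₗ[ℝ] E) (z : SupCompletion E) (s : ℝ) :
    SupCompletion E :=
  SupCompletion.tsum fun n : ℕ => s ^ n • massExt e T z n

/-- For elements of `E` the extended mass function is the usual one. -/
theorem massExt_of {e : E} (he : IsWeakOrderUnit e) (T : E →ₗ[ℝ] E) (x : E) (t : ℝ) :
    massExt e T (SupCompletion.of x) t = mass e T x t := by
  have h : x ⊓ (t + 1) • e - t • e = (x - t • e) ⊓ e := by
    rw [inf_sub, add_smul, one_smul, add_sub_cancel_left]
  unfold massExt mass bandEq bandProj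
  simp only [SupCompletion.trunc_of, abs_abs, h]
  rw [iSup_inf_nsmul_eq he _ _ (posPart_nonneg e), iSup_inf_nsmul_eq he _ _ (negPart_nonneg e)]

theorem genFunExt_of {e : E} (he : IsWeakOrderUnit e) (T : E →ₗ[ℝ] E) (x : E) (s : ℝ) :
    genFunExt e T (SupCompletion.of x) s = genFun e T x s := by
  unfold genFunExt genFun
  simp only [massExt_of he]

theorem isNaturalExt_of {e : E} (he : IsWeakOrderUnit e) (T : E →ₗ[ℝ] E) (x : E) :
    IsNaturalExt e T (SupCompletion.of x) ↔ IsNatural e T x := by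
  unfold IsNaturalExt IsNatural
  simp only [massExt_of he]

end Extended

/-- `P` is a band projection (equivalently: idempotent with `0 ≤ P ≤ I`). -/
def IsBandProjection (P : E →ₗ[ℝ] E) : Prop :=
  (∀ x : E, P (P x) = P x) ∧ ∀ x : E, 0 ≤ x → 0 ≤ P x ∧ P x ≤ x

/-- The linear subspace `F` is an (order) closed Riesz subspace. -/
def IsClosedRieszSubspace (F : Submodule ℝ E) : Prop :=
  (∀ x ∈ F, ∀ y ∈ F, x ⊔ y ∈ F) ∧
    ∀ S : Set E, S ⊆ F → S.Nonempty → ∀ a : E, IsLUB S a → a ∈ F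

/-- `⟨f, R(T)⟩`: the closed Riesz subspace generated by `f` and the range of `T`. -/
def generatedSubspace (T : E →ₗ[ℝ] E) (f : E) : Submodule ℝ E :=
  sInf {F | IsClosedRieszSubspace F ∧ f ∈ F ∧ LinearMap.range T ≤ F}

/-- `T`-independence of a family of band projections:
`T P₁ P₂ ⋯ Pₙ e = T P₁ T P₂ ⋯ T Pₙ e` for any finitely many distinct indices. -/
def TIndepProjections (e : E) (T : E →ₗ[ℝ] E) {ι : Type*} (P : ι → E →ₗ[ℝ] E) : Prop :=
  ∀ l : List ι, l.Nodup →
    T (l.foldr (fun i v => P i v) e) = l.foldr (fun i v => T (P i v)) e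

/-- `T`-independence of a family of elements of `E`. -/
def TIndep (e : E) (T : E →ₗ[ℝ] E) {ι : Type*} (f : ι → E) : Prop :=
  ∀ P : ι → E →ₗ[ℝ] E, (∀ i, IsBandProjection (P i)) →
    (∀ i, P i e ∈ generatedSubspace T (f i)) → TIndepProjections e T P

/-- `x_N = ∑_{n ≥ 1} P_{N = ne} xₙ`, formed in `Eˢ`; it belongs to `E` exactly if the series
converges in order in `E`. -/
noncomputable def randomIndex (e : E) (N : E) (x : ℕ → E) : SupCompletion E :=
  SupCompletion.tsum fun k : ℕ => bandEq N (((k + 1 : ℕ) : ℝ) • e) (x (k + 1))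

end RieszProb

namespace RieszProb

/-! ### Principal band projections: linearity and idempotence -/

section RieszSpace

variable {E : Type*} [ConditionallyCompleteLattice E] [AddCommGroup E] [IsOrderedAddMonoid E]

/-! The bands `{N = ie}`, `i ≥ 0`, exhaust the space, and on each of them `x_N` can be replaced by a
single term: `x_i` if `i ≥ 1`, and `0` if `i = 0`. For `i ≥ 1` independence gives `T P_{N=ie}
P_{x_i=ne} e = T P_{N=ie} π(n)`, where `π` is the mass function common to all `x_i`. Summing over `i
≥ 1` gives `T (I - P_{N=0}) π(n)`, and the band `{N = 0}` adds `T P_{N=0} e` to the mass at `n = 0`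
only (`massExt_randomIndex`). Multiplying by `sⁿ` and summing in `Eˢ` yields the formula; naturality
is the case `s = 1`.

Three facts carry the argument. Band projections are local: `P (P_{x=y} v)` depends only on `P x`,
`P y`, `P v` (`map_bandEq_congr`). Naturality, a statement about `T`, becomes by strict positivity
the statement that the bands `{x = ie}` exhaust `[0, e]` (`IsNatural.isLUB_sum_bandEq`), so
identities may be checked band by band. Order continuous maps and truncations commute with directed
suprema in `Eˢ` (`map_sup`, `isLUB_trunc_sup`). -/

theorem isLUB_bandProj (u : E) {v : E} (hv : 0 ≤ v) :
    IsLUB (Set.range fun n : ℕ => v ⊓ n • |u|) (bandProj u v) := by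
  have h0 : ⨆ n : ℕ, (0 : E) ⊓ n • |u| = 0 := by
    have : ∀ n : ℕ, (0 : E) ⊓ n • |u| = 0 := fun n =>
      inf_eq_left.2 (nsmul_nonneg (abs_nonneg u) n)
    simp [this]
  have h : bandProj u v = ⨆ n : ℕ, v ⊓ n • |u| := by
    rw [bandProj, posPart_of_nonneg hv, negPart_of_nonneg hv, h0, sub_zero]
  rw [h]
  exact isLUB_ciSup ⟨v, by rintro _ ⟨n, rfl⟩; exact inf_le_left⟩

theorem bandProj_eq_sub (u v : E) : bandProj u v = bandProj u v⁺ - bandProj u v⁻ := by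
  have h : ∀ w : E, 0 ≤ w → bandProj u w = ⨆ n : ℕ, w ⊓ n • |u| := fun w hw =>
    ((isLUB_bandProj u hw).csSup_eq (Set.range_nonempty _)).symm
  rw [h _ (posPart_nonneg v), h _ (negPart_nonneg v), bandProj]

theorem inf_nsmul_le_bandProj (u : E) {v : E} (hv : 0 ≤ v) (n : ℕ) :
    v ⊓ n • |u| ≤ bandProj u v :=
  (isLUB_bandProj u hv).1 ⟨n, rfl⟩

theorem bandProj_le_of_forall {u v b : E} (hv : 0 ≤ v) (h : ∀ n : ℕ, v ⊓ n • |u| ≤ b) :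
    bandProj u v ≤ b :=
  (isLUB_bandProj u hv).2 (by rintro _ ⟨n, rfl⟩; exact h n)

theorem bandProj_nonneg (u : E) {v : E} (hv : 0 ≤ v) : 0 ≤ bandProj u v := by
  simpa [hv] using inf_nsmul_le_bandProj u hv 0

theorem bandProj_le (u : E) {v : E} (hv : 0 ≤ v) : bandProj u v ≤ v :=
  bandProj_le_of_forall hv fun _ => inf_le_left

theorem inf_add_le_inf_add_inf {a b c : E} (ha : 0 ≤ a) (hb : 0 ≤ b) (hc : 0 ≤ c) :
    (a + b) ⊓ c ≤ a ⊓ c + b ⊓ c := by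
  rw [← sub_le_iff_le_add']
  refine le_inf ?_ ?_
  · rw [sub_le_iff_le_add', inf_add]
    refine le_inf ?_ ?_
    · exact inf_le_left
    · exact inf_le_right.trans (le_add_of_nonneg_right hb)
  · exact (sub_le_self _ (le_inf ha hc)).trans inf_le_right

theorem bandProj_add_of_nonneg (u : E) {v w : E} (hv : 0 ≤ v) (hw : 0 ≤ w) :
    bandProj u (v + w) = bandProj u v + bandProj u w := by
  have hvw := add_nonneg hv hw
  apply le_antisymm
  · exact bandProj_le_of_forall hvw fun n =>
      (inf_add_le_inf_add_inf hv hw (nsmul_nonneg (abs_nonneg u) n)).trans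
        (add_le_add (inf_nsmul_le_bandProj u hv n) (inf_nsmul_le_bandProj u hw n))
  · rw [← le_sub_iff_add_le]
    -- Superadditivity: the multiples `n` and `m` of `|u|` used for `v` and `w` combine to `n + m`.
    refine bandProj_le_of_forall hv fun n => ?_
    rw [le_sub_comm]
    refine bandProj_le_of_forall hw fun m => ?_
    rw [le_sub_iff_add_le']
    refine le_trans (le_inf (add_le_add inf_le_left inf_le_left) ?_)
      (inf_nsmul_le_bandProj u hvw (n + m))
    rw [add_nsmul]
    exact add_le_add inf_le_right inf_le_right

theorem bandProj_sub_of_nonneg (u : E) {a b : E} (ha : 0 ≤ a) (hb : 0 ≤ b) :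
    bandProj u (a - b) = bandProj u a - bandProj u b := by
  have h : (a - b)⁺ + b = (a - b)⁻ + a := by
    have := posPart_sub_negPart (a - b)
    rw [← sub_eq_zero] at this ⊢
    rw [← this]; abel
  have h' := congrArg (bandProj u) h
  rw [bandProj_add_of_nonneg u (posPart_nonneg _) hb,
    bandProj_add_of_nonneg u (negPart_nonneg _) ha] at h'
  rw [bandProj_eq_sub, sub_eq_sub_iff_add_eq_add, h', add_comm]

theorem bandProj_add (u v w : E) : bandProj u (v + w) = bandProj u v + bandProj u w := by
  have h : v + w = (v⁺ + w⁺) - (v⁻ + w⁻) := by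
    rw [add_sub_add_comm, posPart_sub_negPart, posPart_sub_negPart]
  rw [h, bandProj_sub_of_nonneg u (add_nonneg (posPart_nonneg _) (posPart_nonneg _))
    (add_nonneg (negPart_nonneg _) (negPart_nonneg _)),
    bandProj_add_of_nonneg u (posPart_nonneg _) (posPart_nonneg _),
    bandProj_add_of_nonneg u (negPart_nonneg _) (negPart_nonneg _),
    bandProj_eq_sub u v, bandProj_eq_sub u w, add_sub_add_comm]

theorem bandProj_bandProj_of_nonneg (u : E) {v : E} (hv : 0 ≤ v) :
    bandProj u (bandProj u v) = bandProj u v := by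
  have h0 := bandProj_nonneg u hv
  refine le_antisymm (bandProj_le u h0) (bandProj_le_of_forall hv fun n => ?_)
  exact (le_inf (inf_nsmul_le_bandProj u hv n) inf_le_right).trans (inf_nsmul_le_bandProj u h0 n)

theorem bandProj_zero_left {v : E} (hv : 0 ≤ v) : bandProj 0 v = 0 :=
  le_antisymm (bandProj_le_of_forall hv fun n => by simp) (bandProj_nonneg 0 hv)

theorem bandProj_abs_left (u v : E) : bandProj |u| v = bandProj u v := by
  unfold bandProj; rw [abs_abs]

theorem bandProj_abs_self (u : E) : bandProj u |u| = |u| :=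
  le_antisymm (bandProj_le u (abs_nonneg u))
    (by simpa using inf_nsmul_le_bandProj u (abs_nonneg u) 1)

/-- Adding this infimum to `v ⊓ n • |u|` stays below `v ⊓ (n + 1) • |u|`, so `P_u v` could absorb
it. -/
theorem sub_bandProj_inf_abs_le (u : E) {v : E} (hv : 0 ≤ v) : (v - bandProj u v) ⊓ |u| ≤ 0 := by
  have h : bandProj u v ≤ bandProj u v - (v - bandProj u v) ⊓ |u| := by
    refine bandProj_le_of_forall hv fun n => ?_
    rw [le_sub_iff_add_le]
    refine le_trans (le_inf ?_ ?_) (inf_nsmul_le_bandProj u hv (n + 1))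
    · calc _ ≤ bandProj u v + (v - bandProj u v) :=
            add_le_add (inf_nsmul_le_bandProj u hv n) inf_le_left
        _ = v := by abel
    · rw [succ_nsmul]
      exact add_le_add inf_le_right inf_le_right
  simpa using h

/-- The principal band generated by an element above a weak order unit is the whole space. -/
theorem bandProj_eq_self {e u v : E} (he : IsWeakOrderUnit e) (hu : e ≤ |u|) (hv : 0 ≤ v) :
    bandProj u v = v := by
  have h0 : 0 ≤ v - bandProj u v := sub_nonneg.2 (bandProj_le u hv)
  refine (sub_eq_zero.1 (he.2 _ ?_)).symm
  rw [abs_of_nonneg h0]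
  exact le_antisymm ((inf_le_inf_left _ hu).trans (sub_bandProj_inf_abs_le u hv)) (le_inf h0 he.1)

theorem isLUB_inf_right {S : Set E} {a : E} (h : IsLUB S a) (c : E) :
    IsLUB ((fun s => s ⊓ c) '' S) (a ⊓ c) := by
  constructor
  · rintro _ ⟨s, hs, rfl⟩
    exact inf_le_inf_right c (h.1 hs)
  · intro b hb
    -- `a ⊓ c - s ⊓ c ≤ a - s`, so every `s ∈ S` lies below `a - (a ⊓ c - b)`
    have : a ≤ a - (a ⊓ c - b) := h.2 fun s hs => by
      have h1 : s ⊓ c ≤ b := hb ⟨s, hs, rfl⟩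
      have h2 : a ⊓ c ≤ (a - s) + s ⊓ c := by
        rw [add_inf, sub_add_cancel]
        exact inf_le_inf_left _ (le_add_of_nonneg_left (sub_nonneg.2 (h.1 hs)))
      have h3 : a ⊓ c - b ≤ a - s := by
        rw [sub_le_iff_le_add]; exact h2.trans (add_le_add_right h1 _)
      rw [le_sub_comm]; exact h3
    simpa using this

variable [Module ℝ E] [IsOrderedModule ℝ E]

theorem bandProj_smul_le (u : E) {v : E} (hv : 0 ≤ v) {c : ℝ} (hc : 0 < c) :
    bandProj u (c • v) ≤ c • bandProj u v := by
  refine bandProj_le_of_forall (smul_nonneg hc.le hv) fun n => ?_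
  obtain ⟨m, hm⟩ := exists_nat_ge (c⁻¹ * n)
  have h : c⁻¹ • (c • v ⊓ n • |u|) ≤ v ⊓ m • |u| := by
    refine le_inf ?_ ?_
    · calc _ ≤ c⁻¹ • c • v := smul_le_smul_of_nonneg_left inf_le_left (inv_nonneg.2 hc.le)
        _ = v := inv_smul_smul₀ hc.ne' v
    · calc _ ≤ c⁻¹ • n • |u| := smul_le_smul_of_nonneg_left inf_le_right (inv_nonneg.2 hc.le)
        _ = (c⁻¹ * n : ℝ) • |u| := by rw [← Nat.cast_smul_eq_nsmul ℝ n, smul_smul]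
        _ ≤ (m : ℝ) • |u| := smul_le_smul_of_nonneg_right hm (abs_nonneg u)
        _ = m • |u| := Nat.cast_smul_eq_nsmul ℝ m _
  calc c • v ⊓ n • |u| = c • c⁻¹ • (c • v ⊓ n • |u|) := (smul_inv_smul₀ hc.ne' _).symm
    _ ≤ c • bandProj u v :=
      smul_le_smul_of_nonneg_left (h.trans (inf_nsmul_le_bandProj u hv m)) hc.le

theorem bandProj_smul_of_nonneg (u : E) {v : E} (hv : 0 ≤ v) {c : ℝ} (hc : 0 ≤ c) :
    bandProj u (c • v) = c • bandProj u v := by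
  rcases hc.eq_or_lt with rfl | hc
  · rw [zero_smul, zero_smul]
    exact le_antisymm (bandProj_le u le_rfl) (bandProj_nonneg u le_rfl)
  refine le_antisymm (bandProj_smul_le u hv hc) ?_
  have h := bandProj_smul_le u (smul_nonneg hc.le hv) (inv_pos.2 hc)
  rw [inv_smul_smul₀ hc.ne'] at h
  calc c • bandProj u v ≤ c • c⁻¹ • bandProj u (c • v) := smul_le_smul_of_nonneg_left h hc.le
    _ = _ := smul_inv_smul₀ hc.ne' _

theorem bandProj_smul (u v : E) (c : ℝ) : bandProj u (c • v) = c • bandProj u v := by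
  rcases le_total 0 c with hc | hc
  · conv_lhs => rw [← posPart_sub_negPart v, smul_sub]
    rw [bandProj_sub_of_nonneg u (smul_nonneg hc (posPart_nonneg _))
      (smul_nonneg hc (negPart_nonneg _)), bandProj_smul_of_nonneg u (posPart_nonneg _) hc,
      bandProj_smul_of_nonneg u (negPart_nonneg _) hc, ← smul_sub, ← bandProj_eq_sub]
  · have hc' : 0 ≤ -c := neg_nonneg.2 hc
    have h : c • v = (-c) • v⁻ - (-c) • v⁺ := by
      rw [← smul_sub, ← neg_sub v⁺, posPart_sub_negPart, smul_neg, neg_smul, neg_neg]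
    rw [h, bandProj_sub_of_nonneg u (smul_nonneg hc' (negPart_nonneg _))
      (smul_nonneg hc' (posPart_nonneg _)), bandProj_smul_of_nonneg u (posPart_nonneg _) hc',
      bandProj_smul_of_nonneg u (negPart_nonneg _) hc', ← smul_sub, bandProj_eq_sub u v,
      ← neg_sub (bandProj u v⁺), smul_neg, neg_smul, neg_neg]

/-- The band projection `P_{x = y}` as a linear map. -/
noncomputable def bandEqₗ (x y : E) : E →ₗ[ℝ] E where
  toFun := bandEq x y
  map_add' v w := by simp only [bandEq, bandProj_add]; abel
  map_smul' c v := by simp only [bandEq, bandProj_smul, RingHom.id_apply, smul_sub]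

@[simp]
theorem bandEqₗ_apply (x y v : E) : bandEqₗ x y v = bandEq x y v := rfl

theorem isBandProjection_bandEqₗ (x y : E) : IsBandProjection (bandEqₗ x y) := by
  refine ⟨fun v => ?_, fun v hv => ⟨?_, ?_⟩⟩
  · have h : bandProj |x - y| (bandProj |x - y| v) = bandProj |x - y| v := by
      rw [bandProj_eq_sub _ v, bandProj_sub_of_nonneg _ (bandProj_nonneg _ (posPart_nonneg _))
        (bandProj_nonneg _ (negPart_nonneg _)), bandProj_bandProj_of_nonneg _ (posPart_nonneg _),
        bandProj_bandProj_of_nonneg _ (negPart_nonneg _)]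
    have h2 := map_sub (bandEqₗ x y) v (bandProj |x - y| v)
    change bandEqₗ x y (v - bandProj |x - y| v) = _
    rw [h2]
    simp [bandEq, h]
  · exact sub_nonneg.2 (bandProj_le _ hv)
  · exact sub_le_self _ (bandProj_nonneg _ hv)

end RieszSpace

/-! ### Locality of band projections -/

section BandProjection

variable {E : Type*} [ConditionallyCompleteLattice E] [AddCommGroup E] [IsOrderedAddMonoid E]
  [Module ℝ E]

namespace IsBandProjection

variable {P : E →ₗ[ℝ] E}

theorem monotone (hP : IsBandProjection P) : Monotone P := fun a b h => by
  have := (hP.2 (b - a) (sub_nonneg.2 h)).1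
  rwa [map_sub, sub_nonneg] at this

/-- Since `P ≤ I`, the images of `a⁺` and `a⁻` remain disjoint, so `P a = P a⁺ - P a⁻` is the
decomposition of `P a` into positive and negative part. -/
theorem map_posPart (hP : IsBandProjection P) (a : E) : P a⁺ = (P a)⁺ := by
  obtain ⟨h1, h2⟩ := hP.2 _ (posPart_nonneg a)
  obtain ⟨h3, h4⟩ := hP.2 _ (negPart_nonneg a)
  have h : P a⁺ ⊓ P a⁻ = 0 := by
    refine le_antisymm ((inf_le_inf h2 h4).trans ?_) (le_inf h1 h3)
    rw [posPart_inf_negPart_eq_zero]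
  have hs : P a⁺ + P a⁻ = P a⁺ ⊔ P a⁻ := by rw [← inf_add_sup, h, zero_add]
  have ha : P a = P a⁺ - P a⁻ := by rw [← map_sub, posPart_sub_negPart]
  calc P a⁺ = (P a⁺ ⊔ P a⁻) - P a⁻ := by rw [← hs, add_sub_cancel_right]
    _ = (P a)⁺ := by rw [sup_sub, sub_self, ← ha, posPart_def]

theorem map_inf (hP : IsBandProjection P) (a b : E) : P (a ⊓ b) = P a ⊓ P b := by
  have h : ∀ x y : E, x ⊓ y = x - (x - y)⁺ := fun x y => by
    rw [posPart_def, sub_eq_add_neg, neg_sup, neg_sub, add_inf, add_sub_cancel, neg_zero,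
      add_zero, inf_comm]
  rw [h, h, map_sub, hP.map_posPart, map_sub]

theorem map_abs (hP : IsBandProjection P) (a : E) : P |a| = |P a| := by
  rw [← posPart_add_negPart a, ← posPart_add_negPart (P a), map_add, hP.map_posPart,
    ← posPart_neg, hP.map_posPart, map_neg, posPart_neg]

/-- As `P a - P s ≤ a - s`, an upper bound `b` of the image forces `s ≤ a - (P a - b)` for all `s ∈
S`. No directedness is needed. -/
theorem isLUB_image (hP : IsBandProjection P) {S : Set E} {a : E} (h : IsLUB S a) :
    IsLUB (P '' S) (P a) := by
  constructor
  · rintro _ ⟨s, hs, rfl⟩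
    exact hP.monotone (h.1 hs)
  · intro b hb
    have : a ≤ a - (P a - b) := h.2 fun s hs => by
      rw [le_sub_comm]
      calc P a - b ≤ P a - P s := sub_le_sub_left (hb ⟨s, hs, rfl⟩) _
        _ = P (a - s) := (map_sub _ _ _).symm
        _ ≤ a - s := (hP.2 _ (sub_nonneg.2 (h.1 hs))).2
    simpa using this

/-- Band projections commute with the formation of principal bands. -/
theorem map_bandProj (hP : IsBandProjection P) (u : E) {v : E} (hv : 0 ≤ v) :
    P (bandProj u v) = bandProj (P u) (P v) := by
  refine (hP.isLUB_image (isLUB_bandProj u hv)).unique ?_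
  convert isLUB_bandProj (P u) (hP.2 v hv).1 using 1
  rw [← Set.range_comp]
  congr 1
  ext n
  simp [hP.map_inf, hP.map_abs]

theorem map_bandEq (hP : IsBandProjection P) (x y : E) {v : E} (hv : 0 ≤ v) :
    P (bandEq x y v) = bandEq (P x) (P y) (P v) := by
  rw [bandEq, bandEq, map_sub, hP.map_bandProj _ hv, hP.map_abs, map_sub]

theorem map_bandEq_congr (hP : IsBandProjection P) {x x' y y' v : E} (hx : P x = P x')
    (hy : P y = P y') (hv : 0 ≤ v) : P (bandEq x y v) = P (bandEq x' y' v) := by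
  rw [hP.map_bandEq x y hv, hP.map_bandEq x' y' hv, hx, hy]

theorem map_bandLe_congr (hP : IsBandProjection P) {x x' y y' v : E} (hx : P x = P x')
    (hy : P y = P y') (hv : 0 ≤ v) : P (bandLe x y v) = P (bandLe x' y' v) := by
  simp only [bandLe, map_sub, hP.map_bandProj _ hv, hP.map_posPart, hx, hy]

end IsBandProjection

end BandProjection

/-! ### The bands `{x = y}`, and comparison of multiples of `e` -/

section Components

variable {E : Type*} [ConditionallyCompleteLattice E] [AddCommGroup E] [IsOrderedAddMonoid E]

theorem bandEq_self (x : E) {v : E} (hv : 0 ≤ v) : bandEq x x v = v := by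
  rw [bandEq, sub_self, abs_zero, bandProj_zero_left hv, sub_zero]

theorem bandEq_nonneg (x y : E) {v : E} (hv : 0 ≤ v) : 0 ≤ bandEq x y v :=
  sub_nonneg.2 (bandProj_le _ hv)

theorem bandEq_le (x y : E) {v : E} (hv : 0 ≤ v) : bandEq x y v ≤ v :=
  sub_le_self _ (bandProj_nonneg _ hv)

theorem bandEq_abs_sub (x y : E) : bandEq x y |x - y| = 0 := by
  rw [bandEq, bandProj_abs_left, bandProj_abs_self, sub_self]

variable [Module ℝ E] [IsOrderedModule ℝ E] {e : E}

theorem bandEqₗ_left (x y : E) : bandEqₗ x y x = bandEqₗ x y y := by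
  have h : |bandEqₗ x y (x - y)| = 0 := by
    rw [← (isBandProjection_bandEqₗ x y).map_abs]
    exact bandEq_abs_sub x y
  rw [← sub_eq_zero, ← map_sub]
  exact le_antisymm ((le_abs_self _).trans h.le) (neg_nonpos.1 ((neg_le_abs _).trans h.le))

theorem le_abs_smul_sub_smul (he : 0 ≤ e) {i j : ℕ} (hij : i ≠ j) :
    e ≤ |(i : ℝ) • e - (j : ℝ) • e| := by
  rw [← sub_smul]
  rcases lt_or_gt_of_ne hij with h | h
  · refine le_trans ?_ (neg_le_abs _)
    rw [← neg_smul]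
    have : (1 : ℝ) ≤ -((i : ℝ) - j) := by
      have : (i : ℝ) + 1 ≤ j := by exact_mod_cast h
      linarith
    simpa using smul_le_smul_of_nonneg_right this he
  · refine le_trans ?_ (le_abs_self _)
    have : (1 : ℝ) ≤ (i : ℝ) - j := by
      have : (j : ℝ) + 1 ≤ i := by exact_mod_cast h
      linarith
    simpa using smul_le_smul_of_nonneg_right this he

theorem bandEq_smul_smul_of_ne (he : IsWeakOrderUnit e) {i j : ℕ} (hij : i ≠ j) {v : E}
    (hv : 0 ≤ v) : bandEq ((i : ℝ) • e) ((j : ℝ) • e) v = 0 := by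
  rw [bandEq, bandProj_abs_left, bandProj_eq_self he (le_abs_smul_sub_smul he.1 hij) hv, sub_self]

theorem bandEqₗ_bandEq_of_ne (he : IsWeakOrderUnit e) (x : E) {i j : ℕ} (hij : i ≠ j) {v : E}
    (hv : 0 ≤ v) : bandEqₗ x ((i : ℝ) • e) (bandEq x ((j : ℝ) • e) v) = 0 := by
  rw [(isBandProjection_bandEqₗ x ((i : ℝ) • e)).map_bandEq_congr (bandEqₗ_left _ _) rfl hv,
    bandEq_smul_smul_of_ne he hij hv, map_zero]

theorem bandLe_smul_smul_of_le (he : 0 ≤ e) {a b : ℝ} (hab : a ≤ b) {v : E} (hv : 0 ≤ v) :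
    bandLe (a • e) (b • e) v = v := by
  have h : (a • e - b • e)⁺ = 0 := by
    rw [posPart_eq_zero, sub_nonpos]
    exact smul_le_smul_of_nonneg_right hab he
  rw [bandLe, h, bandProj_zero_left hv, sub_zero]

theorem bandLe_smul_smul_of_add_one_le (he : IsWeakOrderUnit e) {a b : ℝ} (hab : b + 1 ≤ a)
    {v : E} (hv : 0 ≤ v) : bandLe (a • e) (b • e) v = 0 := by
  have h : e ≤ |(a • e - b • e)⁺| := by
    refine le_trans ?_ ((le_posPart _).trans (le_abs_self _))
    rw [← sub_smul]
    simpa using smul_le_smul_of_nonneg_right (by linarith : (1 : ℝ) ≤ a - b) he.1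
  rw [bandLe, bandProj_eq_self he h hv, sub_self]

end Components

section Directed

variable {E : Type*} [ConditionallyCompleteLattice E] [AddCommGroup E] [IsOrderedAddMonoid E]

theorem directedOn_range_sum {f : ℕ → E} (hf : ∀ n, 0 ≤ f n) :
    DirectedOn (· ≤ ·) (Set.range fun F : Finset ℕ => ∑ i ∈ F, f i) := by
  rintro _ ⟨F, rfl⟩ _ ⟨G, rfl⟩
  exact ⟨_, ⟨F ∪ G, rfl⟩,
    Finset.sum_le_sum_of_subset_of_nonneg Finset.subset_union_left fun _ _ _ => hf _,
    Finset.sum_le_sum_of_subset_of_nonneg Finset.subset_union_right fun _ _ _ => hf _⟩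

end Directed

/-! ### Order continuity of `T` and natural elements -/

section ConditionalExpectation

variable {E : Type*} [ConditionallyCompleteLattice E] [AddCommGroup E] [IsOrderedAddMonoid E]
  [Module ℝ E] {e : E} {T : E →ₗ[ℝ] E}

namespace IsConditionalRieszTriple

theorem monotone (hT : IsConditionalRieszTriple e T) : Monotone T := fun a b h => by
  have := hT.positive (b - a) (sub_nonneg.2 h)
  rwa [map_sub, sub_nonneg] at this

theorem isLUB_image (hT : IsConditionalRieszTriple e T) {S : Set E} {a : E} (hne : S.Nonempty)
    (hd : DirectedOn (· ≤ ·) S) (h : IsLUB S a) : IsLUB (T '' S) (T a) := by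
  -- Order continuity concerns sets decreasing to `0`, hence the passage to `a - S`.
  have h0 : IsGLB ((fun s => a - s) '' S) 0 := by
    constructor
    · rintro _ ⟨s, hs, rfl⟩
      exact sub_nonneg.2 (h.1 hs)
    · intro b hb
      have : a ≤ a - b := h.2 fun s hs => le_sub_comm.1 (hb ⟨s, hs, rfl⟩)
      simpa using this
  have h1 := hT.order_continuous _ (hne.image _) (by
    rintro _ ⟨s, hs, rfl⟩ _ ⟨t, ht, rfl⟩
    obtain ⟨r, hr, h1, h2⟩ := hd s hs t ht
    exact ⟨_, ⟨r, hr, rfl⟩, sub_le_sub_left h1 a, sub_le_sub_left h2 a⟩) h0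
  constructor
  · rintro _ ⟨s, hs, rfl⟩
    exact hT.monotone (h.1 hs)
  · intro b hb
    have : T a - b ≤ 0 := h1.2 (by
      rintro _ ⟨_, ⟨s, hs, rfl⟩, rfl⟩
      rw [map_sub]
      exact sub_le_sub_left (hb ⟨s, hs, rfl⟩) _)
    exact sub_nonpos.1 this

theorem isLUB_sum (hT : IsConditionalRieszTriple e T) {f : ℕ → E} (hf : ∀ n, 0 ≤ f n) {a : E}
    (h : IsLUB (Set.range fun F : Finset ℕ => ∑ i ∈ F, f i) a) :
    IsLUB (Set.range fun F : Finset ℕ => ∑ i ∈ F, T (f i)) (T a) := by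
  have := hT.isLUB_image (Set.range_nonempty _) (directedOn_range_sum hf) h
  rw [← Set.range_comp] at this
  simpa [Function.comp_def, map_sum] using this

omit [IsOrderedAddMonoid E] in
theorem eq_zero_of_map_eq_zero (hT : IsConditionalRieszTriple e T) {a : E} (ha : 0 ≤ a)
    (h : T a = 0) : a = 0 := by
  by_contra hne
  exact (hT.strictly_positive a (lt_of_le_of_ne ha (Ne.symm hne))).ne' h

end IsConditionalRieszTriple

theorem mass_nonneg (hT : IsConditionalRieszTriple e T) (x : E) (t : ℝ) : 0 ≤ mass e T x t :=
  hT.positive _ (bandEq_nonneg _ _ hT.weak_unit.1)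

theorem mass_le (hT : IsConditionalRieszTriple e T) (x : E) (t : ℝ) : mass e T x t ≤ e :=
  (hT.monotone (bandEq_le _ _ hT.weak_unit.1)).trans hT.map_unit.le

omit [IsOrderedAddMonoid E] in
theorem map_mass (hT : IsConditionalRieszTriple e T) (x : E) (t : ℝ) :
    T (mass e T x t) = mass e T x t :=
  hT.projection _

variable [IsOrderedModule ℝ E] {x : E}

/-- Finite sums of the disjoint projections `P_{x = ie}` do not exceed the identity. -/
theorem sum_bandEq_le (he : IsWeakOrderUnit e) (x : E) {v : E} (hv : 0 ≤ v) (F : Finset ℕ) :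
    ∑ i ∈ F, bandEq x ((i : ℝ) • e) v ≤ v := by
  induction F using Finset.induction_on with
  | empty => simpa using hv
  | insert j F hj ih =>
    have hB := isBandProjection_bandEqₗ x ((j : ℝ) • e)
    rw [Finset.sum_insert hj, ← le_sub_iff_add_le]
    have h0 : bandEqₗ x ((j : ℝ) • e) (∑ i ∈ F, bandEq x ((i : ℝ) • e) v) = 0 := by
      rw [map_sum]
      exact Finset.sum_eq_zero fun i hi =>
        bandEqₗ_bandEq_of_ne he x (by rintro rfl; exact hj hi) hv
    have h1 := (hB.2 _ (sub_nonneg.2 ih)).2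
    rwa [map_sub, h0, sub_zero] at h1

/-- For `v = e`, the supremum `q` of the partial sums satisfies `T q = e = T e`, and strict
positivity gives `q = e`. For general `v`, the remainder of the series for `v` is at most the
remainder for `e`. -/
theorem IsNatural.isLUB_sum_bandEq (hT : IsConditionalRieszTriple e T) (hx : IsNatural e T x)
    {v : E} (hv : 0 ≤ v) (hve : v ≤ e) :
    IsLUB (Set.range fun F : Finset ℕ => ∑ i ∈ F, bandEq x ((i : ℝ) • e) v) v := by
  have he := hT.weak_unit
  set S : E → Finset ℕ → E := fun v F => ∑ i ∈ F, bandEq x ((i : ℝ) • e) v with hS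
  have hle : IsLUB (Set.range (S e)) e := by
    have hbdd : BddAbove (Set.range (S e)) :=
      ⟨e, by rintro _ ⟨F, rfl⟩; exact sum_bandEq_le he x he.1 F⟩
    have hq := isLUB_csSup (Set.range_nonempty (S e)) hbdd
    set q := sSup (Set.range (S e))
    have hqe : q ≤ e := hq.2 (by rintro _ ⟨F, rfl⟩; exact sum_bandEq_le he x he.1 F)
    have h1 := hT.isLUB_sum (fun n => bandEq_nonneg x ((n : ℝ) • e) he.1) hq
    have h2 := (SupCompletion.sup_eq_of_iff _ (Set.range_nonempty _) _).1 hx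
    have h3 : T q = e := h1.unique h2
    have h4 : e - q = 0 := hT.eq_zero_of_map_eq_zero (sub_nonneg.2 hqe)
      (by rw [map_sub, h3, hT.map_unit, sub_self])
    rwa [← sub_eq_zero.1 h4] at hq
  constructor
  · rintro _ ⟨F, rfl⟩
    exact sum_bandEq_le he x hv F
  · intro b hb
    have : e ≤ e - (v - b) := hle.2 (by
      rintro _ ⟨F, rfl⟩
      have h1 := sum_bandEq_le he x (sub_nonneg.2 hve) F
      have h2 : ∑ i ∈ F, bandEq x ((i : ℝ) • e) (e - v) = S e F - S v F := by
        rw [hS]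
        simp only [← bandEqₗ_apply, map_sub, Finset.sum_sub_distrib]
      rw [h2] at h1
      rw [le_sub_comm]
      calc v - b ≤ v - S v F := sub_le_sub_left (hb ⟨F, rfl⟩) v
        _ ≤ e - S e F := by
          rw [sub_le_sub_iff]
          rw [sub_le_iff_le_add, sub_add_eq_add_sub, le_sub_iff_add_le] at h1
          rw [add_comm v]
          exact h1)
    simpa using this

/-- An element vanishing on each of the bands `{x = ie}` of a natural element vanishes. -/
theorem IsNatural.eq_zero_of_forall (hT : IsConditionalRieszTriple e T) (hx : IsNatural e T x)
    {d : E} (hd : ∀ i : ℕ, bandEq x ((i : ℝ) • e) d = 0) : d = 0 := by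
  have h0 : 0 ≤ |d| ⊓ e := le_inf (abs_nonneg d) hT.weak_unit.1
  refine hT.weak_unit.2 d (le_antisymm ?_ h0)
  refine (hx.isLUB_sum_bandEq hT h0 inf_le_right).2 ?_
  rintro _ ⟨F, rfl⟩
  refine Finset.sum_nonpos fun i _ => ?_
  have hB := isBandProjection_bandEqₗ x ((i : ℝ) • e)
  calc bandEqₗ x ((i : ℝ) • e) (|d| ⊓ e) ≤ bandEqₗ x ((i : ℝ) • e) |d| := hB.monotone inf_le_left
    _ = 0 := by rw [hB.map_abs, bandEqₗ_apply, hd, abs_zero]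

theorem IsNatural.nonneg (hT : IsConditionalRieszTriple e T) (hx : IsNatural e T x) : 0 ≤ x := by
  rw [← negPart_eq_zero]
  refine hx.eq_zero_of_forall hT fun i => ?_
  have hB := isBandProjection_bandEqₗ x ((i : ℝ) • e)
  have h0 : (0 : E) ≤ (i : ℝ) • e := smul_nonneg (Nat.cast_nonneg i) hT.weak_unit.1
  rw [← bandEqₗ_apply, ← posPart_neg, hB.map_posPart, map_neg, bandEqₗ_left, ← map_neg,
    ← hB.map_posPart, posPart_neg, negPart_eq_zero.2 h0, map_zero]

/-- Elements of `[0, e]` have the same conditional expectation if this holds on each band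
`{x = ie}`. -/
theorem IsNatural.map_eq_of_forall (hT : IsConditionalRieszTriple e T) (hx : IsNatural e T x)
    {v w : E} (hv : 0 ≤ v) (hve : v ≤ e) (hw : 0 ≤ w) (hwe : w ≤ e)
    (h : ∀ i : ℕ, T (bandEq x ((i : ℝ) • e) v) = T (bandEq x ((i : ℝ) • e) w)) : T v = T w := by
  have h1 := hT.isLUB_sum (fun n => bandEq_nonneg x ((n : ℝ) • e) hv)
    (hx.isLUB_sum_bandEq hT hv hve)
  have h2 := hT.isLUB_sum (fun n => bandEq_nonneg x ((n : ℝ) • e) hw)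
    (hx.isLUB_sum_bandEq hT hw hwe)
  simp only [h] at h1
  exact h1.unique h2

/-- The mass function of a natural element is determined by its distribution function. -/
theorem IsNatural.mass_eq (hT : IsConditionalRieszTriple e T) (hx : IsNatural e T x) (j : ℕ) :
    mass e T x j = distFun e T x j - distFun e T x ((j : ℝ) - 1) := by
  -- The identity already holds before applying `T`. On `{x = ie}`, where `x` may be replaced by
  -- `ie`, it reads `0 = e - e`, `e = e - 0` or `0 = 0 - 0` as `i < j`, `i = j` or `i > j`.
  have he := hT.weak_unit
  suffices h : bandEq x ((j : ℝ) • e) e -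
      (bandLe x ((j : ℝ) • e) e - bandLe x (((j : ℝ) - 1) • e) e) = 0 by
    rw [mass, distFun, distFun, ← map_sub, sub_eq_zero.1 h]
  refine hx.eq_zero_of_forall hT fun i => ?_
  have hB := isBandProjection_bandEqₗ x ((i : ℝ) • e)
  have hl := bandEqₗ_left x ((i : ℝ) • e)
  rw [← bandEqₗ_apply, map_sub, map_sub, hB.map_bandEq_congr hl rfl he.1,
    hB.map_bandLe_congr hl (rfl : _ = bandEqₗ _ _ ((j : ℝ) • e)) he.1,
    hB.map_bandLe_congr hl (rfl : _ = bandEqₗ _ _ (((j : ℝ) - 1) • e)) he.1]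
  rcases lt_trichotomy i j with h | rfl | h
  · have h' : (i : ℝ) + 1 ≤ j := by exact_mod_cast h
    rw [bandEq_smul_smul_of_ne he h.ne he.1, bandLe_smul_smul_of_le he.1 (by linarith) he.1,
      bandLe_smul_smul_of_le he.1 (by linarith) he.1]
    simp [-bandEqₗ_apply]
  · rw [bandEq_self _ he.1, bandLe_smul_smul_of_le he.1 le_rfl he.1,
      bandLe_smul_smul_of_add_one_le he (by linarith) he.1]
    simp [-bandEqₗ_apply]
  · have h' : (j : ℝ) + 1 ≤ i := by exact_mod_cast h
    rw [bandEq_smul_smul_of_ne he h.ne' he.1,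
      bandLe_smul_smul_of_add_one_le he (by linarith) he.1,
      bandLe_smul_smul_of_add_one_le he (by linarith) he.1]
    simp [-bandEqₗ_apply]

end ConditionalExpectation

/-! ### Suprema, truncations, maps and sums in `Eˢ` -/

namespace SupCompletion

section

variable {E : Type*} [ConditionallyCompleteLattice E]

theorem sup_le_sup {A B : Set E} (hA : A.Nonempty) (hB : B.Nonempty)
    (h : ∀ a ∈ A, ∃ b ∈ B, a ≤ b) : sup A hA ≤ sup B hB := fun _ hy D hD => hy D fun a ha => by
  obtain ⟨b, hb, hab⟩ := h a ha
  exact D.lower' _ _ hab (hD hb)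

theorem subset_sup (A : Set E) (hA : A.Nonempty) : A ⊆ (sup A hA).carrier :=
  fun _ ha _ hD => hD ha

theorem map_of {f : E → E} (hf : Monotone f) (a : E) : (of a).map f = of (f a) :=
  (sup_eq_of_iff _ _ _).2 ⟨by rintro _ ⟨u, hu, rfl⟩; exact hf hu, fun _ hb => hb ⟨a, le_rfl, rfl⟩⟩

end

section

variable {E : Type*} [ConditionallyCompleteLattice E] [AddCommGroup E] [IsOrderedAddMonoid E]

theorem of_add_of (a b : E) : of a + of b = of (a + b) :=
  (sup_eq_of_iff _ _ _).2
    ⟨by rintro _ ⟨u, hu, v, hv, rfl⟩; exact add_le_add hu hv,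
      fun _ hc => hc ⟨a, le_rfl, b, le_rfl, rfl⟩⟩

/-- An element of `E` below the supremum of `A` in `Eˢ` is the supremum of its infima with the
elements of `A`. -/
theorem isLUB_of_mem_sup {A : Set E} {hA : A.Nonempty} {y : E} (hy : y ∈ (sup A hA).carrier) :
    IsLUB ((fun a => a ⊓ y) '' A) y := by
  -- The `y` with this property form an element of `Eˢ` above `A`, hence above `sup A`.
  let D : SupCompletion E :=
    { carrier := {y | IsLUB ((fun a => a ⊓ y) '' A) y}
      nonempty' := hA.imp fun a ha =>
        ⟨by rintro _ ⟨b, _, rfl⟩; exact inf_le_right, fun b hb => by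
          have : a ⊓ a ≤ b := hb ⟨a, ha, rfl⟩
          rwa [inf_idem] at this⟩
      lower' := fun u v huv hv => by
        have h := isLUB_inf_right (hv : IsLUB _ _) u
        rw [Set.image_image, inf_eq_right.2 huv] at h
        simp only [inf_assoc, inf_eq_right.2 huv] at h
        exact h
      sup_closed' := fun S hS _ b hb => by
        refine ⟨by rintro _ ⟨a, _, rfl⟩; exact inf_le_right, fun c hc => hb.2 fun s hs => ?_⟩
        refine (hS hs : IsLUB _ _).2 ?_
        rintro _ ⟨a, ha, rfl⟩
        exact (inf_le_inf_left a (hb.1 hs)).trans (hc ⟨a, ha, rfl⟩) }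
  exact hy D fun a ha =>
    ⟨by rintro _ ⟨b, _, rfl⟩; exact inf_le_right, fun b hb => by
      have : a ⊓ a ≤ b := hb ⟨a, ha, rfl⟩
      rwa [inf_idem] at this⟩

theorem isLUB_trunc_sup (A : Set E) (hA : A.Nonempty) (c : E) :
    IsLUB ((fun a => a ⊓ c) '' A) ((sup A hA).trunc c) := by
  have hmem : ∀ a ∈ A, a ⊓ c ∈ {u | u ∈ (sup A hA).carrier ∧ u ≤ c} := fun a ha =>
    ⟨(sup A hA).lower' _ _ inf_le_left (subset_sup A hA ha), inf_le_right⟩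
  have h : IsLUB {u | u ∈ (sup A hA).carrier ∧ u ≤ c} ((sup A hA).trunc c) :=
    isLUB_csSup (hA.imp' _ hmem) ⟨c, fun _ hu => hu.2⟩
  refine ⟨by rintro _ ⟨a, ha, rfl⟩; exact h.1 (hmem a ha), fun b hb => h.2 fun u hu => ?_⟩
  refine (isLUB_of_mem_sup hu.1).2 ?_
  rintro _ ⟨a, ha, rfl⟩
  exact (inf_le_inf_left a hu.2).trans (hb ⟨a, ha, rfl⟩)

/-- Each `u` below `sup A` is the directed supremum of the `a ⊓ u`; `f` preserves it, and `f (a ⊓ u)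
≤ f a`. -/
theorem map_sup {f : E → E} (hf : Monotone f)
    (hlub : ∀ (S : Set E) (a : E), S.Nonempty → DirectedOn (· ≤ ·) S → IsLUB S a →
      IsLUB (f '' S) (f a)) {A : Set E} (hA : A.Nonempty) (hd : DirectedOn (· ≤ ·) A) :
    (sup A hA).map f = sup (f '' A) (hA.image f) := by
  refine le_antisymm (fun y hy => hy _ ?_)
    fun y hy D hD => hy D ((Set.image_mono (subset_sup A hA)).trans hD)
  rintro _ ⟨u, hu, rfl⟩
  have hd' : DirectedOn (· ≤ ·) ((fun a => a ⊓ u) '' A) := by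
    rintro _ ⟨a, ha, rfl⟩ _ ⟨b, hb, rfl⟩
    obtain ⟨c, hc, hac, hbc⟩ := hd a ha b hb
    exact ⟨_, ⟨c, hc, rfl⟩, inf_le_inf_right u hac, inf_le_inf_right u hbc⟩
  refine (sup (f '' A) (hA.image f)).sup_closed' _ ?_ ((hA.image _).image f) _
    (hlub _ u (hA.image _) hd' (isLUB_of_mem_sup hu))
  rintro _ ⟨_, ⟨a, ha, rfl⟩, rfl⟩
  exact lower' _ _ _ (hf inf_le_left) (subset_sup _ _ ⟨a, ha, rfl⟩)

theorem sup_add_of {A : Set E} (hA : A.Nonempty) (c : E) :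
    sup A hA + of c = sup ((fun a => a + c) '' A) (hA.image _) := by
  apply le_antisymm
  · intro y hy
    refine hy _ ?_
    rintro _ ⟨u, hu, v, hv, rfl⟩ D hD
    -- The translate of `D` by `-c` is an element of `Eˢ` above `A`.
    let D' : SupCompletion E :=
      { carrier := {y | y + c ∈ D.carrier}
        nonempty' := hA.imp fun a ha => hD ⟨a, ha, rfl⟩
        lower' := fun u v huv hv => D.lower' _ _ (add_le_add_left huv c) hv
        sup_closed' := fun S hS hne a ha => by
          refine D.sup_closed' ((fun s => s + c) '' S) ?_ (hne.image _) _ ⟨?_, fun b hb => ?_⟩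
          · rintro _ ⟨s, hs, rfl⟩; exact hS hs
          · rintro _ ⟨s, hs, rfl⟩; exact add_le_add_left (ha.1 hs) c
          · exact le_sub_iff_add_le.1 (ha.2 fun s hs => le_sub_iff_add_le.2 (hb ⟨s, hs, rfl⟩)) }
    exact D.lower' _ _ (add_le_add_right hv u) (hu D' fun a ha => hD ⟨a, ha, rfl⟩)
  · intro y hy D hD
    refine hy D ?_
    rintro _ ⟨a, ha, rfl⟩
    exact hD ⟨a, subset_sup A hA ha, c, le_rfl, rfl⟩

theorem tsum_add_of {f : ℕ → E} (hf : ∀ n, 0 ≤ f n) {c : E} (hc : 0 ≤ c) :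
    tsum f + of c = tsum fun n => f n + if n = 0 then c else 0 := by
  rw [tsum, sup_add_of, tsum]
  refine le_antisymm (sup_le_sup _ _ ?_) (sup_le_sup _ _ ?_)
  · rintro _ ⟨_, ⟨F, rfl⟩, rfl⟩
    refine ⟨_, ⟨insert 0 F, rfl⟩, ?_⟩
    simp only [Finset.sum_add_distrib, Finset.sum_ite_eq', Finset.mem_insert_self, if_true]
    exact add_le_add_left
      (Finset.sum_le_sum_of_subset_of_nonneg (Finset.subset_insert _ _) fun _ _ _ => hf _) c
  · rintro _ ⟨F, rfl⟩
    refine ⟨_, ⟨_, ⟨F, rfl⟩, rfl⟩, ?_⟩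
    simp only [Finset.sum_add_distrib, Finset.sum_ite_eq']
    refine add_le_add_right ?_ _
    split_ifs <;> simp [hc]

variable [Module ℝ E]

theorem map_tsum {f : E →ₗ[ℝ] E} (hf : Monotone f)
    (hlub : ∀ (S : Set E) (a : E), S.Nonempty → DirectedOn (· ≤ ·) S → IsLUB S a →
      IsLUB (f '' S) (f a)) {u : ℕ → E} (hu : ∀ n, 0 ≤ u n) :
    (tsum u).map f = tsum fun n => f (u n) := by
  rw [tsum, map_sup hf hlub _ (directedOn_range_sum hu), tsum]
  congr 1
  rw [← Set.range_comp]
  simp [Function.comp_def, map_sum]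

end

end SupCompletion

/-! ### The mass function and generating function of `x_N` -/

section RandomIndex

variable {E : Type*} [ConditionallyCompleteLattice E] [AddCommGroup E] [IsOrderedAddMonoid E]
  [Module ℝ E]

theorem IsBandProjection.id_sub {P : E →ₗ[ℝ] E} (hP : IsBandProjection P) :
    IsBandProjection (LinearMap.id - P) := by
  refine ⟨fun x => ?_, fun x hx => ⟨sub_nonneg.2 (hP.2 x hx).2, sub_le_self _ (hP.2 x hx).1⟩⟩
  simp [hP.1 x]

namespace IsClosedRieszSubspace

variable {F : Submodule ℝ E}

theorem inf_mem (hF : IsClosedRieszSubspace F) {x y : E} (hx : x ∈ F) (hy : y ∈ F) :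
    x ⊓ y ∈ F := by
  rw [← neg_neg (x ⊓ y), neg_inf]
  exact F.neg_mem (hF.1 _ (F.neg_mem hx) _ (F.neg_mem hy))

omit [IsOrderedAddMonoid E] in
theorem abs_mem (hF : IsClosedRieszSubspace F) {x : E} (hx : x ∈ F) : |x| ∈ F :=
  hF.1 _ hx _ (F.neg_mem hx)

theorem bandProj_mem (hF : IsClosedRieszSubspace F) {u v : E} (hu : u ∈ F) (hv : v ∈ F)
    (hv0 : 0 ≤ v) : bandProj u v ∈ F := by
  refine hF.2 _ ?_ (Set.range_nonempty _) _ (isLUB_bandProj u hv0)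
  rintro _ ⟨n, rfl⟩
  exact hF.inf_mem hv (F.nsmul_mem (hF.abs_mem hu) n)

end IsClosedRieszSubspace

theorem bandEq_mem_generatedSubspace {e : E} {T : E →ₗ[ℝ] E} (hT : IsConditionalRieszTriple e T)
    (x : E) (t : ℝ) : bandEq x (t • e) e ∈ generatedSubspace T x := by
  rw [generatedSubspace, Submodule.mem_sInf]
  rintro F ⟨hF, hx, hTF⟩
  have he : e ∈ F := hTF ⟨e, hT.map_unit⟩
  exact F.sub_mem he
    (hF.bandProj_mem (hF.abs_mem (F.sub_mem hx (F.smul_mem t he))) he hT.weak_unit.1)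

/-- Where `y` exceeds `(t + 1)e` it differs from `te`, so truncation there is harmless. -/
theorem bandEq_inf_add_one_smul {e : E} (he : IsWeakOrderUnit e) (y : E) (t : ℝ) :
    bandEq (y ⊓ (t + 1) • e) (t • e) e = bandEq y (t • e) e := by
  have h : y ⊓ (t + 1) • e - t • e = (y - t • e) ⊓ e := by
    rw [inf_sub, add_smul, one_smul, add_sub_cancel_left]
  unfold bandEq bandProj
  simp only [abs_abs, h]
  rw [iSup_inf_nsmul_eq he _ _ (posPart_nonneg e), iSup_inf_nsmul_eq he _ _ (negPart_nonneg e)]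

variable [IsOrderedModule ℝ E] {e : E} {T : E →ₗ[ℝ] E} {N : E} {x : ℕ → E}

theorem TIndep.map_bandEq_bandEq (hT : IsConditionalRieszTriple e T) {y N : E}
    (h : TIndep e T ![y, N]) (s t : ℝ) :
    T (bandEq N (s • e) (bandEq y (t • e) e)) = T (bandEq N (s • e) (mass e T y t)) := by
  have := h ![bandEqₗ y (t • e), bandEqₗ N (s • e)]
    (by intro i; fin_cases i <;> exact isBandProjection_bandEqₗ _ _)
    (by intro i; fin_cases i <;> exact bandEq_mem_generatedSubspace hT _ _)
    -- This order makes the projection for `N` the outer one, so that the inner `T` produces the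
    -- mass of `y`.
    [1, 0] (by decide)
  simpa [mass] using this

/-- On the band `{N = ie}` the element `x_N` agrees with the `i`-th summand. -/
theorem bandEqₗ_trunc_randomIndex (he : IsWeakOrderUnit e) (hx : ∀ n, 1 ≤ n → 0 ≤ x n) (c : E)
    (i : ℕ) :
    bandEqₗ N ((i : ℝ) • e) ((randomIndex e N x).trunc c) =
      bandEqₗ N ((i : ℝ) • e) ((if i = 0 then 0 else x i) ⊓ c) := by
  have hB := isBandProjection_bandEqₗ N ((i : ℝ) • e)
  set R := bandEqₗ N ((i : ℝ) • e) with hR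
  have hterm : ∀ k : ℕ, R (bandEq N (((k + 1 : ℕ) : ℝ) • e) (x (k + 1))) =
      if k + 1 = i then R (x i) else 0 := fun k => by
    split_ifs with h
    · rw [h]; exact hB.1 _
    · exact bandEqₗ_bandEq_of_ne he N (Ne.symm h) (hx _ (Nat.le_add_left _ _))
  have hsum : ∀ F : Finset ℕ, R (∑ k ∈ F, bandEq N (((k + 1 : ℕ) : ℝ) • e) (x (k + 1))) =
      ∑ k ∈ F, if k + 1 = i then R (x i) else 0 := fun F => by
    rw [map_sum]; exact Finset.sum_congr rfl fun k _ => hterm k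
  have hRi : 0 ≤ R (if i = 0 then 0 else x i) := by
    refine (hB.2 _ ?_).1
    split_ifs with h
    · exact le_rfl
    · exact hx i (Nat.one_le_iff_ne_zero.2 h)
  have hle : ∀ F : Finset ℕ, (∑ k ∈ F, if k + 1 = i then R (x i) else 0) ≤
      R (if i = 0 then 0 else x i) := fun F => by
    cases i with
    | zero => simp
    | succ j =>
      simp only [Nat.add_right_cancel_iff, Finset.sum_ite_eq']
      split_ifs with h1 h2 h2
      · simp at h2
      · exact le_rfl
      · simp at h2
      · simpa using hRi
  have hL := hB.isLUB_image (SupCompletion.isLUB_trunc_sup _ (Set.range_nonempty fun F : Finset ℕ =>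
    ∑ k ∈ F, bandEq N (((k + 1 : ℕ) : ℝ) • e) (x (k + 1))) c)
  refine hL.unique ⟨?_, fun b hb => ?_⟩
  · rintro _ ⟨_, ⟨_, ⟨F, rfl⟩, rfl⟩, rfl⟩
    rw [hB.map_inf, hB.map_inf, hsum]
    exact inf_le_inf_right _ (hle F)
  -- Index `k` carries the summand `k + 1`, so `{i - 1}` picks out `x i`. For `i = 0` it is `{0}`,
  -- whose term vanishes on `{N = 0}`.
  · have := hb ⟨_, ⟨_, ⟨{i - 1}, rfl⟩, rfl⟩, rfl⟩
    rw [hB.map_inf, hsum] at this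
    rw [hB.map_inf]
    refine le_trans (inf_le_inf_right _ ?_) this
    cases i <;> simp

theorem bandEqₗ_zero_bandEq_trunc_randomIndex (he : IsWeakOrderUnit e)
    (hx : ∀ n, 1 ≤ n → 0 ≤ x n) (n : ℕ) :
    bandEqₗ N 0 (bandEq ((randomIndex e N x).trunc (((n : ℝ) + 1) • e)) ((n : ℝ) • e) e) =
      if n = 0 then bandEq N 0 e else 0 := by
  have hc : 0 ≤ ((n : ℝ) + 1) • e := smul_nonneg (by positivity) he.1
  have h := bandEqₗ_trunc_randomIndex (N := N) he hx (((n : ℝ) + 1) • e) 0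
  simp only [Nat.cast_zero, if_true, inf_eq_left.2 hc] at h
  have h0 : bandEqₗ N ((0 : ℝ) • e) 0 = bandEqₗ N ((0 : ℝ) • e) (((0 : ℕ) : ℝ) • e) := by simp
  rw [h0] at h
  rw [zero_smul] at h
  rw [(isBandProjection_bandEqₗ N 0).map_bandEq_congr h rfl he.1]
  split_ifs with hn
  · rw [hn, bandEq_self _ he.1, bandEqₗ_apply]
  · rw [bandEq_smul_smul_of_ne he (Ne.symm hn) he.1, map_zero]

theorem bandEq_bandEq_trunc_randomIndex (he : IsWeakOrderUnit e)
    (hx : ∀ n, 1 ≤ n → 0 ≤ x n) (n : ℕ) {i : ℕ} (hi : i ≠ 0) :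
    bandEq N ((i : ℝ) • e)
        (bandEq ((randomIndex e N x).trunc (((n : ℝ) + 1) • e)) ((n : ℝ) • e) e) =
      bandEq N ((i : ℝ) • e) (bandEq (x i) ((n : ℝ) • e) e) := by
  have h := bandEqₗ_trunc_randomIndex (N := N) he hx (((n : ℝ) + 1) • e) i
  rw [if_neg hi] at h
  rw [← bandEqₗ_apply, (isBandProjection_bandEqₗ N ((i : ℝ) • e)).map_bandEq_congr h rfl he.1,
    bandEq_inf_add_one_smul he, bandEqₗ_apply]

/-- The mass function of `x_N`. -/
theorem massExt_randomIndex (hT : IsConditionalRieszTriple e T) (hN : IsNatural e T N)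
    (hx : ∀ n, 1 ≤ n → IsNatural e T (x n))
    (hdist : ∀ n, 1 ≤ n → ∀ t : ℝ, distFun e T (x n) t = distFun e T (x 1) t)
    (hindep : ∀ n, 1 ≤ n → TIndep e T ![x n, N]) (n : ℕ) :
    massExt e T (randomIndex e N x) n =
      T (mass e T (x 1) n - bandEq N 0 (mass e T (x 1) n)) +
        if n = 0 then T (bandEq N 0 e) else 0 := by
  have he := hT.weak_unit
  have hx0 : ∀ n, 1 ≤ n → 0 ≤ x n := fun n hn => (hx n hn).nonneg hT
  have hB := isBandProjection_bandEqₗ N 0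
  set q := bandEq ((randomIndex e N x).trunc (((n : ℝ) + 1) • e)) ((n : ℝ) • e) e with hq
  set p := mass e T (x 1) n with hp
  have hq0 : 0 ≤ q := bandEq_nonneg _ _ he.1
  have hqe : q ≤ e := bandEq_le _ _ he.1
  have hp0 : 0 ≤ p := mass_nonneg hT _ _
  have hpe : p ≤ e := mass_le hT _ _
  have hmass : ∀ i, 1 ≤ i → mass e T (x i) n = p := fun i hi => by
    rw [hp, (hx i hi).mass_eq hT, (hx 1 le_rfl).mass_eq hT, hdist i hi, hdist i hi]
  have hcompl : ∀ v : E, 0 ≤ v → v ≤ e → 0 ≤ v - bandEq N 0 v ∧ v - bandEq N 0 v ≤ e :=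
    fun v hv hve => ⟨sub_nonneg.2 (bandEq_le _ _ hv),
      (sub_le_self _ (bandEq_nonneg _ _ hv)).trans hve⟩
  -- Off `{N = 0}`, compared on each band `{N = ie}`: both sides vanish for `i = 0`, and
  -- independence with equality of the masses settles `i ≥ 1`.
  have key : T (q - bandEq N 0 q) = T (p - bandEq N 0 p) := by
    refine hN.map_eq_of_forall hT (hcompl q hq0 hqe).1 (hcompl q hq0 hqe).2 (hcompl p hp0 hpe).1
      (hcompl p hp0 hpe).2 fun i => ?_
    rw [← bandEqₗ_apply N _ (q - _), ← bandEqₗ_apply N _ (p - _), map_sub (bandEqₗ N _) q,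
      map_sub (bandEqₗ N _) p]
    rcases eq_or_ne i 0 with rfl | hi
    · have h : bandEqₗ N (((0 : ℕ) : ℝ) • e) = bandEqₗ N 0 := by simp
      rw [h, ← bandEqₗ_apply N 0 q, ← bandEqₗ_apply N 0 p, hB.1 q, hB.1 p, sub_self, sub_self]
    · have h : ∀ v : E, 0 ≤ v → bandEqₗ N ((i : ℝ) • e) (bandEq N 0 v) = 0 := fun v hv => by
        simpa [-bandEqₗ_apply] using bandEqₗ_bandEq_of_ne he N hi hv
      rw [h q hq0, h p hp0, sub_zero, sub_zero, bandEqₗ_apply, bandEqₗ_apply, hq,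
        bandEq_bandEq_trunc_randomIndex he hx0 n hi]
      have hi1 := Nat.one_le_iff_ne_zero.2 hi
      rw [(hindep i hi1).map_bandEq_bandEq hT, hmass i hi1]
  have h0 := bandEqₗ_zero_bandEq_trunc_randomIndex (N := N) he hx0 n
  rw [← hq, bandEqₗ_apply] at h0
  have hsplit : q = (q - bandEq N 0 q) + bandEq N 0 q := (sub_add_cancel _ _).symm
  change T q = _
  rw [hsplit, map_add, key, h0, apply_ite T, map_zero]

theorem genFunExt_randomIndex (hT : IsConditionalRieszTriple e T) (hN : IsNatural e T N)
    (hx : ∀ n, 1 ≤ n → IsNatural e T (x n))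
    (hdist : ∀ n, 1 ≤ n → ∀ t : ℝ, distFun e T (x n) t = distFun e T (x 1) t)
    (hindep : ∀ n, 1 ≤ n → TIndep e T ![x n, N]) {s : ℝ} (hs : 0 ≤ s) :
    genFunExt e T (randomIndex e N x) s =
      ((genFun e T (x 1) s).map (fun v => v - bandEq N 0 v)).map T +
        SupCompletion.of (T (bandEq N 0 e)) := by
  have hQ := (isBandProjection_bandEqₗ N 0).id_sub
  have hu : ∀ n : ℕ, 0 ≤ s ^ n • mass e T (x 1) n := fun n =>
    smul_nonneg (pow_nonneg hs n) (mass_nonneg hT _ _)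
  have hQu := fun n => (hQ.2 _ (hu n)).1
  have h1 : (genFun e T (x 1) s).map (fun v => v - bandEq N 0 v) =
      SupCompletion.tsum fun n : ℕ =>
        (LinearMap.id - bandEqₗ N 0 : E →ₗ[ℝ] E) (s ^ n • mass e T (x 1) n) :=
    SupCompletion.map_tsum hQ.monotone (fun _ _ _ _ h => hQ.isLUB_image h) hu
  rw [h1, SupCompletion.map_tsum hT.monotone (fun _ _ h1 h2 h3 => hT.isLUB_image h1 h2 h3) hQu,
    SupCompletion.tsum_add_of (fun n => hT.positive _ (hQu n))
      (hT.positive _ (bandEq_nonneg _ _ hT.weak_unit.1)), genFunExt]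
  congr 1
  ext n
  rw [massExt_randomIndex hT hN hx hdist hindep, map_smul, map_smul, smul_add]
  congr 1
  split_ifs with h
  -- The constant sits at `n = 0`, where `s ^ 0 = 1` even for `s = 0`.
  · rw [h, pow_zero, one_smul]
  · rw [smul_zero]

omit [IsOrderedAddMonoid E] [IsOrderedModule ℝ E] in
theorem genFun_one_of_isNatural {y : E} (hy : IsNatural e T y) :
    genFun e T y 1 = SupCompletion.of e := by
  simp only [genFun, one_pow, one_smul]
  exact hy

theorem isNaturalExt_randomIndex (hT : IsConditionalRieszTriple e T) (hN : IsNatural e T N)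
    (hx : ∀ n, 1 ≤ n → IsNatural e T (x n))
    (hdist : ∀ n, 1 ≤ n → ∀ t : ℝ, distFun e T (x n) t = distFun e T (x 1) t)
    (hindep : ∀ n, 1 ≤ n → TIndep e T ![x n, N]) : IsNaturalExt e T (randomIndex e N x) := by
  have hQ := (isBandProjection_bandEqₗ N 0).id_sub
  have h := genFunExt_randomIndex hT hN hx hdist hindep zero_le_one
  rw [genFun_one_of_isNatural (hx 1 le_rfl), SupCompletion.map_of (f := fun v => v - bandEq N 0 v)
    hQ.monotone, SupCompletion.map_of hT.monotone, SupCompletion.of_add_of, ← map_add,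
    sub_add_cancel, hT.map_unit] at h
  simp only [genFunExt, one_pow, one_smul] at h
  exact h

/-- As `N ≥ 0`, the projections `P_{N>0}` and `P_{N=0}` are complementary; hence `T P_{N=0} e = 0`,
and `T` is strictly positive. -/
theorem bandEq_zero_eq_zero_of_map_bandGt (hT : IsConditionalRieszTriple e T)
    (hN : IsNatural e T N) (h : T (bandGt N 0 e) = e) : bandEq N 0 e = 0 := by
  have hN0 := hN.nonneg hT
  refine hT.eq_zero_of_map_eq_zero (bandEq_nonneg _ _ hT.weak_unit.1) ?_
  rw [bandGt, sub_zero, posPart_of_nonneg hN0] at h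
  rw [bandEq, sub_zero, abs_of_nonneg hN0, map_sub, h, hT.map_unit, sub_self]

end RandomIndex

end RieszProb

theorem mainTheorem9 {E : Type*} [ConditionallyCompleteLattice E] [AddCommGroup E]
    [IsOrderedAddMonoid E] [Module ℝ E] [IsOrderedModule ℝ E]
    (e : E) (T : E →ₗ[ℝ] E) (hT : RieszProb.IsConditionalRieszTriple e T)
    (N : E) (x : ℕ → E)
    (hN : RieszProb.IsNatural e T N)
    (hx : ∀ n, 1 ≤ n → RieszProb.IsNatural e T (x n))
    (hdist : ∀ n, 1 ≤ n → ∀ t : ℝ,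
      RieszProb.distFun e T (x n) t = RieszProb.distFun e T (x 1) t)
    (hindep : ∀ n, 1 ≤ n → RieszProb.TIndep e T ![x n, N]) :
    RieszProb.IsNaturalExt e T (RieszProb.randomIndex e N x) ∧
    (∀ s : ℝ, 0 ≤ s →
      RieszProb.genFunExt e T (RieszProb.randomIndex e N x) s =
        ((RieszProb.genFun e T (x 1) s).map (fun v => v - RieszProb.bandEq N 0 v)).map T +
          RieszProb.SupCompletion.of (T (RieszProb.bandEq N 0 e))) ∧
    (T (RieszProb.bandGt N 0 e) = e →
      ∀ s : ℝ, 0 ≤ s →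
        RieszProb.genFunExt e T (RieszProb.randomIndex e N x) s =
          RieszProb.genFun e T (x 1) s) := by
  refine ⟨RieszProb.isNaturalExt_randomIndex hT hN hx hdist hindep,
    fun s hs => RieszProb.genFunExt_randomIndex hT hN hx hdist hindep hs, fun h s _ => ?_⟩
  have h0 := RieszProb.bandEq_zero_eq_zero_of_map_bandGt hT hN h
  -- The masses lie in `[0, e]`, so `P_{N=0} e = 0` annihilates them too.
  have hm : ∀ n : ℕ, RieszProb.bandEq N 0 (RieszProb.mass e T (x 1) n) = 0 := fun n =>
    le_antisymm
      (((RieszProb.isBandProjection_bandEqₗ N 0).monotone (RieszProb.mass_le hT (x 1) n)).trans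
        h0.le)
      (RieszProb.bandEq_nonneg _ _ (RieszProb.mass_nonneg hT _ _))
  unfold RieszProb.genFunExt RieszProb.genFun
  congr 1
  ext n
  rw [RieszProb.massExt_randomIndex hT hN hx hdist hindep, hm, h0, map_zero, ite_self, add_zero,
    sub_zero, RieszProb.map_mass hT]
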